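/- Write $\mathbb{BC}=\{z+jw : z,w\in\mathbb C\}$ for the commutative ring of bicomplex numbers, where $j^2=-1$ and $j$ commutes with the imaginary unit $i$ of $\mathbb C$. Put $e_1=\frac{1+ij}{2}$ and $e_2=\frac{1-ij}{2}$; every $Z=z+jw$ is uniquely $Z=e_1z_1+e_2z_2$ with $z_1=z-iw$, $z_2=z+iw\in\mathbb C$, and algebraic operations are componentwise in $(z_1,z_2)$. Put $Z^{\dagger_3}=\bar z-j\bar w=e_1\overline{z_1}+e_2\overline{z_2}$ and $|Z|_k=e_1|z_1|+e_2|z_2|$. The hyperbolic numbers are $\mathbb D=\{e_1\alpha_1+e_2\alpha_2:\alpha_1,\alpha_2\in\mathbb R\}$, partially ordered by $\alpha\le'\beta$ iff $\beta-\alpha=e_1\gamma_1+e_2\gamma_2$ with $\gamma_1,\gamma_2\ge 0$; for $\alpha=e_1\alpha_1+e_2\alpha_2$ with $\alpha_1,\alpha_2\ge0$ put $\alpha^{1/2}=e_1\sqrt{\alpha_1}+e_2\sqrt{\alpha_2}$. Let $\mathbb U_{\mathbb{BC}}=\{e_1z_1+e_2z_2 : |z_1|<1,\ |z_2|<1\}$.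 The bicomplex Hardy space $H^2(\mathbb U_{\mathbb{BC}})$ is the set of bicomplex holomorphic functions $f:\mathbb U_{\mathbb{BC}}\to\mathbb{BC}$ (i.e. $\lim (f(U)-f(Z))/(U-Z)$ exists at every $Z\in\mathbb U_{\mathbb{BC}}$, as $U\to Z$ with $U-Z$ invertible) of the form $f(Z)=\sum_{n\ge0}a_nZ^n$ on $\mathbb U_{\mathbb{BC}}$, with $a_n\in\mathbb{BC}$ and $\sum_n|a_n|_k^2$ convergent; its $\mathbb D$-valued norm is $\|f\|_{\mathbb D}=\left(\sum_{n\ge0}|a_n|_k^2\right)^{1/2}$. **Theorem.** Let $\lambda\in\mathbb{BC}$ with $|\lambda|_k=1$, let $W\in\mathbb U_{\mathbb{BC}}$, and let $\Psi:\mathbb U_{\mathbb{BC}}\to\mathbb U_{\mathbb{BC}}$ be the disc automorphism $$\Psi(Z)=\lambda\,\frac{Z+W}{1+W^{\dagger_3}Z}.$$ Then for every $f\in H^2(\mathbb U_{\mathbb{BC}})$ the function $C_\Psi f=f\circ\Psi$ belongs to $H^2(\mathbb U_{\mathbb{BC}})$ and $$\left(\frac{1-|\Psi(0)|_k}{1+|\Psi(0)|_k}\right)^{1/2}\|f\|_{\mathbb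 D}\ \le'\ \|C_\Psi f\|_{\mathbb D}\ \le'\ \left(\frac{1+|\Psi(0)|_k}{1-|\Psi(0)|_k}\right)^{1/2}\|f\|_{\mathbb D}.$$ -/

import Mathlib

open Filter Topology

noncomputable section

/-- The bicomplex numbers `z + j w` with `z, w : ℂ` and `j ^ 2 = -1`, a commutative ring.
For `Z = z + j w`, `Z.re` is `z` and `Z.im` is `w` (both complex numbers). -/
abbrev Bicomplex : Type := QuadraticAlgebra ℂ (-1) 0

namespace Bicomplex

/-- The underlying pair `(z, w)` of `z + j w`, in `ℂ × ℂ` with the Euclidean norm. -/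
def toPair : Bicomplex →+ WithLp 2 (ℂ × ℂ) where
  toFun Z := WithLp.toLp 2 (Z.re, Z.im)
  map_zero' := rfl
  map_add' _ _ := rfl

theorem toPair_injective : Function.Injective toPair := by
  intro Z U h
  have h' : (Z.re, Z.im) = (U.re, U.im) := (WithLp.toLp_injective 2) h
  exact QuadraticAlgebra.ext (congrArg Prod.fst h') (congrArg Prod.snd h')

/-- The Euclidean norm `√(|z| ^ 2 + |w| ^ 2)` on the bicomplex numbers, and its topology. -/
instance instNormedAddCommGroup : NormedAddCommGroup Bicomplex :=
  NormedAddCommGroup.induced Bicomplex (WithLp 2 (ℂ × ℂ)) toPair toPair_injective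

/-- The idempotent `e₁ = (1 + i j) / 2`. -/
def e₁ : Bicomplex := ⟨1 / 2, Complex.I / 2⟩

/-- The idempotent `e₂ = (1 - i j) / 2`. -/
def e₂ : Bicomplex := ⟨1 / 2, -Complex.I / 2⟩

/-- The first idempotent component `z₁ = z - i w`. -/
def c₁ (Z : Bicomplex) : ℂ := Z.re - Complex.I * Z.im

/-- The second idempotent component `z₂ = z + i w`. -/
def c₂ (Z : Bicomplex) : ℂ := Z.re + Complex.I * Z.im

/-- The bicomplex number `e₁ z₁ + e₂ z₂`. -/
def ofIdem (z₁ z₂ : ℂ) : Bicomplex := z₁ • e₁ + z₂ • e₂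

/-- The conjugation `(z + j w)^{†₃} = conj z - j conj w`. -/
def conj₃ (Z : Bicomplex) : Bicomplex :=
  ⟨(starRingEnd ℂ) Z.re, -(starRingEnd ℂ) Z.im⟩

/-- The inverse `Z⁻¹ = Z^{†₂} / |Z|_i ^ 2 = (z - j w) / (z ^ 2 + w ^ 2)`. It is the inverse of `Z`
in the ring exactly when `z ^ 2 + w ^ 2 ≠ 0`, that is when `Z` is invertible. -/
instance instInv : Inv Bicomplex :=
  ⟨fun Z => (Z.re ^ 2 + Z.im ^ 2)⁻¹ • (⟨Z.re, -Z.im⟩ : Bicomplex)⟩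

/-- The quotient `Z / U = Z U⁻¹`, meant for invertible `U`. -/
instance instDiv : Div Bicomplex := ⟨fun Z U => Z * U⁻¹⟩

/-- The set `𝔻` of hyperbolic numbers `x + k y`, with `x, y` real and `k = i j`. -/
def hyperbolic : Set Bicomplex :=
  {α | ∃ x y : ℝ, α = ⟨(x : ℂ), Complex.I * (y : ℂ)⟩}

/-- The set `𝔻⁺` of non-negative hyperbolic numbers `e₁ α₁ + e₂ α₂`, `α₁, α₂ ≥ 0`. -/
def hyperbolicNonneg : Set Bicomplex :=
  {α | ∃ α₁ α₂ : ℝ, 0 ≤ α₁ ∧ 0 ≤ α₂ ∧ α = ofIdem α₁ α₂}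

/-- The partial order of `𝔻`: `α ≤' β` when `α, β` are hyperbolic and `β - α ∈ 𝔻⁺`. -/
def HypLE (α β : Bicomplex) : Prop :=
  α ∈ hyperbolic ∧ β ∈ hyperbolic ∧ β - α ∈ hyperbolicNonneg

/-- The square root of a non-negative hyperbolic number:
`√(e₁ α₁ + e₂ α₂) = e₁ √α₁ + e₂ √α₂`. -/
def hypSqrt (α : Bicomplex) : Bicomplex :=
  ofIdem (Real.sqrt (c₁ α).re) (Real.sqrt (c₂ α).re)

/-- The hyperbolic modulus `|Z|_k = e₁ |z₁| + e₂ |z₂|`. -/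
def hypMod (Z : Bicomplex) : Bicomplex := ofIdem ‖c₁ Z‖ ‖c₂ Z‖

theorem c₁_ofIdem (a b : ℂ) : c₁ (ofIdem a b) = a := by
  simp only [c₁, ofIdem, e₁, e₂, QuadraticAlgebra.re_add, QuadraticAlgebra.im_add,
    QuadraticAlgebra.re_smul, QuadraticAlgebra.im_smul, smul_eq_mul]
  linear_combination ((b - a) / 2) * Complex.I_mul_I

theorem c₂_ofIdem (a b : ℂ) : c₂ (ofIdem a b) = b := by
  simp only [c₂, ofIdem, e₁, e₂, QuadraticAlgebra.re_add, QuadraticAlgebra.im_add,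
    QuadraticAlgebra.re_smul, QuadraticAlgebra.im_smul, smul_eq_mul]
  linear_combination ((a - b) / 2) * Complex.I_mul_I

theorem ofIdem_c (Z : Bicomplex) : ofIdem (c₁ Z) (c₂ Z) = Z := by
  ext <;> simp only [c₁, c₂, ofIdem, e₁, e₂, QuadraticAlgebra.re_add, QuadraticAlgebra.im_add,
    QuadraticAlgebra.re_smul, QuadraticAlgebra.im_smul, smul_eq_mul]
  · ring
  · linear_combination (-Z.im) * Complex.I_mul_I

theorem c₁_add (Z U : Bicomplex) : c₁ (Z + U) = c₁ Z + c₁ U := by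
  simp only [c₁, QuadraticAlgebra.re_add, QuadraticAlgebra.im_add]; ring

theorem c₂_add (Z U : Bicomplex) : c₂ (Z + U) = c₂ Z + c₂ U := by
  simp only [c₂, QuadraticAlgebra.re_add, QuadraticAlgebra.im_add]; ring

theorem c₁_one : c₁ 1 = 1 := by
  simp [c₁, QuadraticAlgebra.re_one, QuadraticAlgebra.im_one]

theorem c₂_one : c₂ 1 = 1 := by
  simp [c₂, QuadraticAlgebra.re_one, QuadraticAlgebra.im_one]

theorem c₁_mul (Z U : Bicomplex) : c₁ (Z * U) = c₁ Z * c₁ U := by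
  simp only [c₁, QuadraticAlgebra.re_mul, QuadraticAlgebra.im_mul]
  linear_combination (-Z.im * U.im) * Complex.I_mul_I

theorem c₂_mul (Z U : Bicomplex) : c₂ (Z * U) = c₂ Z * c₂ U := by
  simp only [c₂, QuadraticAlgebra.re_mul, QuadraticAlgebra.im_mul]
  linear_combination (-Z.im * U.im) * Complex.I_mul_I

theorem c₁_conj₃ (Z : Bicomplex) : c₁ (conj₃ Z) = (starRingEnd ℂ) (c₁ Z) := by
  simp [c₁, conj₃]

theorem c₂_conj₃ (Z : Bicomplex) : c₂ (conj₃ Z) = (starRingEnd ℂ) (c₂ Z) := by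
  simp [c₂, conj₃, ← sub_eq_add_neg]

/-- `|Z|_k ^ 2 = Z · Z^{†₃}`. -/
theorem hypMod_sq (Z : Bicomplex) : hypMod Z ^ 2 = Z * conj₃ Z := by
  rw [← ofIdem_c (hypMod Z ^ 2), ← ofIdem_c (Z * conj₃ Z), sq]
  simp only [c₁_mul, c₂_mul, c₁_conj₃, c₂_conj₃, hypMod, c₁_ofIdem, c₂_ofIdem,
    Complex.mul_conj, Complex.normSq_eq_norm_sq]
  push_cast
  simp only [sq]

theorem c₁_mul_c₂ (Z : Bicomplex) : c₁ Z * c₂ Z = Z.re ^ 2 + Z.im ^ 2 := by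
  simp only [c₁, c₂]
  linear_combination (-Z.im ^ 2) * Complex.I_mul_I

theorem inv_def (Z : Bicomplex) :
    Z⁻¹ = (Z.re ^ 2 + Z.im ^ 2)⁻¹ • (⟨Z.re, -Z.im⟩ : Bicomplex) := rfl

theorem div_def (Z U : Bicomplex) : Z / U = Z * U⁻¹ := rfl

theorem c₁_div (Z U : Bicomplex) (h : c₂ U ≠ 0) : c₁ (Z / U) = c₁ Z / c₁ U := by
  have h1 : c₁ U⁻¹ = (c₁ U * c₂ U)⁻¹ * c₂ U := by
    rw [inv_def, ← c₁_mul_c₂]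
    simp only [c₁, c₂, QuadraticAlgebra.re_smul, QuadraticAlgebra.im_smul, smul_eq_mul]
    ring
  rw [div_def, c₁_mul, h1]
  field_simp

theorem c₂_div (Z U : Bicomplex) (h : c₁ U ≠ 0) : c₂ (Z / U) = c₂ Z / c₂ U := by
  have h1 : c₂ U⁻¹ = (c₁ U * c₂ U)⁻¹ * c₁ U := by
    rw [inv_def, ← c₁_mul_c₂]
    simp only [c₁, c₂, QuadraticAlgebra.re_smul, QuadraticAlgebra.im_smul, smul_eq_mul]
    ring
  rw [div_def, c₂_mul, h1]
  field_simp

/-- The unit disc `{e₁ z₁ + e₂ z₂ | |z₁| < 1, |z₂| < 1}` of the bicomplex numbers. -/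
def unitDisc : Set Bicomplex := {Z | ‖c₁ Z‖ < 1 ∧ ‖c₂ Z‖ < 1}

theorem zero_mem_unitDisc : (0 : Bicomplex) ∈ unitDisc := by
  simp [unitDisc, c₁, c₂]

theorem one_add_conj_mul_ne_zero {z w : ℂ} (hz : ‖z‖ < 1) (hw : ‖w‖ < 1) :
    1 + (starRingEnd ℂ) w * z ≠ 0 := by
  intro h
  have h1 : ‖(starRingEnd ℂ) w * z‖ = 1 := by
    rw [eq_neg_of_add_eq_zero_right h, norm_neg, norm_one]
  rw [norm_mul, Complex.norm_conj] at h1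
  nlinarith [norm_nonneg z, norm_nonneg w]

theorem norm_moebius_lt_one {l z w : ℂ} (hl : ‖l‖ = 1) (hz : ‖z‖ < 1) (hw : ‖w‖ < 1) :
    ‖l * ((z + w) / (1 + (starRingEnd ℂ) w * z))‖ < 1 := by
  have h0 := one_add_conj_mul_ne_zero hz hw
  rw [norm_mul, hl, one_mul, norm_div, div_lt_one (norm_pos_iff.mpr h0)]
  have hz' : Complex.normSq z < 1 := by
    rw [Complex.normSq_eq_norm_sq]; nlinarith [norm_nonneg z]
  have hw' : Complex.normSq w < 1 := by
    rw [Complex.normSq_eq_norm_sq]; nlinarith [norm_nonneg w]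
  have key : Complex.normSq (z + w) < Complex.normSq (1 + (starRingEnd ℂ) w * z) := by
    rw [Complex.normSq_apply] at hz' hw' ⊢
    rw [Complex.normSq_apply]
    simp only [Complex.add_re, Complex.add_im, Complex.mul_re, Complex.mul_im, Complex.one_re,
      Complex.one_im, Complex.conj_re, Complex.conj_im]
    nlinarith [mul_pos (sub_pos.mpr hz') (sub_pos.mpr hw')]
  rw [Complex.normSq_eq_norm_sq, Complex.normSq_eq_norm_sq] at key
  exact lt_of_pow_lt_pow_left₀ 2 (norm_nonneg _) key

theorem norm_c_of_hypMod_eq_one {lam : Bicomplex} (h : hypMod lam = 1) :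
    ‖c₁ lam‖ = 1 ∧ ‖c₂ lam‖ = 1 := by
  have h1 := congrArg c₁ h
  have h2 := congrArg c₂ h
  rw [hypMod, c₁_ofIdem, c₁_one] at h1
  rw [hypMod, c₂_ofIdem, c₂_one] at h2
  exact ⟨by exact_mod_cast h1, by exact_mod_cast h2⟩

theorem moebius_mem_unitDisc {lam W Z : Bicomplex} (hlam : hypMod lam = 1)
    (hW : W ∈ unitDisc) (hZ : Z ∈ unitDisc) :
    lam * ((Z + W) / (1 + conj₃ W * Z)) ∈ unitDisc := by
  obtain ⟨hl₁, hl₂⟩ := norm_c_of_hypMod_eq_one hlam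
  have e1 : c₁ (1 + conj₃ W * Z) = 1 + (starRingEnd ℂ) (c₁ W) * c₁ Z := by
    rw [c₁_add, c₁_one, c₁_mul, c₁_conj₃]
  have e2 : c₂ (1 + conj₃ W * Z) = 1 + (starRingEnd ℂ) (c₂ W) * c₂ Z := by
    rw [c₂_add, c₂_one, c₂_mul, c₂_conj₃]
  have n1 := one_add_conj_mul_ne_zero hZ.1 hW.1
  have n2 := one_add_conj_mul_ne_zero hZ.2 hW.2
  constructor
  · rw [c₁_mul, c₁_div _ _ (e2 ▸ n2), e1, c₁_add]
    exact norm_moebius_lt_one hl₁ hZ.1 hW.1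
  · rw [c₂_mul, c₂_div _ _ (e1 ▸ n1), e2, c₂_add]
    exact norm_moebius_lt_one hl₂ hZ.2 hW.2

/-- The disc automorphism `Ψ(Z) = λ (Z + W) / (1 + W^{†₃} Z)`, where `|λ|_k = 1` and `W` lies
in the unit disc. -/
def discAut (lam W : Bicomplex) (hlam : hypMod lam = 1) (hW : W ∈ unitDisc) :
    unitDisc → unitDisc :=
  fun Z => ⟨lam * (((Z : Bicomplex) + W) / (1 + conj₃ W * (Z : Bicomplex))),
    moebius_mem_unitDisc hlam hW Z.2⟩

/-- Bicomplex holomorphy on the unit disc: at each point `Z` of the disc the bicomplex derivative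
`lim (f U - f Z) / (U - Z)` exists, the limit being taken as `U → Z` in the disc with `U - Z`
invertible. -/
def Holomorphic (f : unitDisc → Bicomplex) : Prop :=
  ∀ Z : unitDisc, ∃ L : Bicomplex,
    Tendsto (fun U : unitDisc => (f U - f Z) / ((U : Bicomplex) - (Z : Bicomplex)))
      (𝓝[{U : unitDisc | IsUnit ((U : Bicomplex) - (Z : Bicomplex))}] Z) (𝓝 L)

/-- `f(Z) = ∑ aₙ Zⁿ` on the whole unit disc. -/
def HasPowerSeries (f : unitDisc → Bicomplex) (a : ℕ → Bicomplex) : Prop :=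
  ∀ Z : unitDisc, HasSum (fun n => a n * (Z : Bicomplex) ^ n) (f Z)

/-- The bicomplex Hardy space: the bicomplex holomorphic functions on the unit disc whose sequence
of power series coefficients is square-summable, i.e. `∑ |aₙ|_k ^ 2` converges. -/
def hardySpace : Set (unitDisc → Bicomplex) :=
  {f | Holomorphic f ∧
    ∃ a : ℕ → Bicomplex, HasPowerSeries f a ∧ Summable (fun n => hypMod (a n) ^ 2)}

open Classical in
/-- The power series coefficients of `f` (zero if `f` has no power series on the disc). -/
def coeff (f : unitDisc → Bicomplex) : ℕ → Bicomplex :=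
  if h : ∃ a, HasPowerSeries f a then h.choose else 0

/-- The hyperbolic (`𝔻`-valued) norm `(∑ |aₙ|_k ^ 2) ^ (1 / 2)` of the Hardy space. -/
def hardyNorm (f : unitDisc → Bicomplex) : Bicomplex :=
  hypSqrt (∑' n, hypMod (coeff f n) ^ 2)

/-- The composition operator `C_Φ f = f ∘ Φ`. -/
def compOp (Φ : unitDisc → unitDisc) (f : unitDisc → Bicomplex) : unitDisc → Bicomplex :=
  f ∘ Φ

end Bicomplex

end

noncomputable section

namespace HardyDisc

open ComplexConjugate

/-! In idempotent components everything splits into two copies of the scalar statement on the Hardy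
space of the disc, identified with `ℓ²`. There let `S` be multiplication by `z` and `ψ(z) = l (z +
w) / (1 + w̄ z)`. Since `l (S + w) x` and `(1 + w̄ S) x` have equal norms, `V = l (S + w) (1 + w̄
S)⁻¹`, multiplication by `ψ`, is an isometry. With `κ = 1 / (1 + w̄ z)` and `s = √(1 - |w|²)`, the
vectors `Vⁿ (s κ)` are orthonormal (`exists_moebius_isometry`).

For `f = ∑ aₙ zⁿ`, the vector `y = ∑ aₙ Vⁿ (s κ)` therefore has norm `‖f‖`, and as a function it is
`s (f ∘ ψ) / (1 + w̄ z)`. Hence `f ∘ ψ = s⁻¹ (1 + w̄ S) y`, and the triangle inequality bounds its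
norm between `s⁻¹ (1 - |w|) ‖f‖` and `s⁻¹ (1 + |w|) ‖f‖` (`exists_coeffs_comp_moebius`). As `s² = (1
- |w|) (1 + |w|)` and `|ψ(0)| = |w|`, these are the stated constants. No boundary values or
integrals are needed. -/

theorem hasSum_congr {E : Type*} [AddCommMonoid E] [TopologicalSpace E] {f g : ℕ → E} {x : E}
    (h : ∀ n, f n = g n) : HasSum f x ↔ HasSum g x := by
  rw [funext h]

/-! ### Möbius transforms of an isometry of a Hilbert space -/

section Abstract

variable {H : Type*} [NormedAddCommGroup H] [InnerProductSpace ℂ H]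

/-- For an isometry `S`, the operators `1 + w̄ S` and `l (S + w)` have the same norm at each
vector, for unimodular `l`. -/
theorem norm_smul_shift_add_eq (S : H →ₗᵢ[ℂ] H) {l : ℂ} (hl : ‖l‖ = 1) (w : ℂ) (x : H) :
    ‖l • (S x + w • x)‖ = ‖x + conj w • S x‖ := by
  rw [norm_smul, hl, one_mul]
  have h1 := norm_add_sq (𝕜 := ℂ) (S x) (w • x)
  have h2 := norm_add_sq (𝕜 := ℂ) x (conj w • S x)
  rw [inner_smul_right, ← inner_conj_symm] at h1
  rw [inner_smul_right] at h2
  simp only [norm_smul, S.norm_map, RCLike.norm_conj] at h1 h2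
  -- The cross terms of the two expansions are complex conjugates, so their real parts agree.
  have h3 : RCLike.re (w * conj (inner ℂ x (S x))) = RCLike.re (conj w * inner ℂ x (S x)) := by
    rw [← RCLike.conj_re (w * _)]
    simp
  rw [h3] at h1
  exact (sq_eq_sq₀ (norm_nonneg _) (norm_nonneg _)).1 (by rw [h1, h2])

/-- The wandering vector `κ = (1 + w̄ S)⁻¹ e` of the Möbius transform
`V = l (S + w) (1 + w̄ S)⁻¹` of an isometry `S`, and the orthonormality of its normalized orbit. -/
theorem exists_moebius_isometry [CompleteSpace H] (S : H →ₗᵢ[ℂ] H) {e : H} (he : ‖e‖ = 1)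
    (hS : ∀ x, inner ℂ (S x) e = 0) {l w : ℂ} (hl : ‖l‖ = 1) (hw : ‖w‖ < 1) :
    ∃ (V : H →ₗᵢ[ℂ] H) (κ : H),
      Orthonormal ℂ (fun n : ℕ => (V ^ n) ((Real.sqrt (1 - ‖w‖ ^ 2) : ℂ) • κ)) ∧
      κ + conj w • S κ = e ∧ ∀ x, V x + conj w • S (V x) = l • (S x + w • x) := by
  -- By the Neumann series, `1 + w̄ S` is invertible because `‖w̄ S‖ ≤ |w| < 1`; `R` is its inverse.
  have hlt : ‖-(conj w • S.toContinuousLinearMap)‖ < 1 := by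
    rw [norm_neg, norm_smul, RCLike.norm_conj]
    calc ‖w‖ * ‖S.toContinuousLinearMap‖ ≤ ‖w‖ * 1 := by
          gcongr; exact S.norm_toContinuousLinearMap_le
      _ < 1 := by simpa
  obtain ⟨u, hu⟩ := isUnit_one_sub_of_norm_lt_one hlt
  set R : H →L[ℂ] H := ↑u⁻¹
  have hD : ∀ x, (u : H →L[ℂ] H) x = x + conj w • S x := by
    intro x; rw [hu]; simp
  have hDR : ∀ x, R x + conj w • S (R x) = x := by
    intro x
    rw [← hD]
    have : (u : H →L[ℂ] H) * R = 1 := u.mul_inv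
    exact congrArg (fun T : H →L[ℂ] H => T x) this
  let N : H →L[ℂ] H := l • (S.toContinuousLinearMap + w • 1)
  have hN : ∀ x, N x = l • (S x + w • x) := fun x => by simp [N]
  let V : H →ₗᵢ[ℂ] H := ⟨(N.comp R : H →L[ℂ] H).toLinearMap, fun x => by
    change ‖N (R x)‖ = ‖x‖
    rw [hN, norm_smul_shift_add_eq S hl, hDR]⟩
  have hV : ∀ x, V x = l • (S (R x) + w • R x) := fun x => hN (R x)
  refine ⟨V, R e, ?_, hDR e, ?_⟩
  · set κ := R e
    have hκe : κ + conj w • S κ = e := hDR e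
    -- Pairing `κ + w̄ S κ = e` with `e` gives `⟪κ, e⟫ = 1`; expanding `‖κ - e‖² = |w|² ‖κ‖²` then
    -- determines `‖κ‖`.
    have hnorm : ‖κ‖ ^ 2 * (1 - ‖w‖ ^ 2) = 1 := by
      have h1 : inner ℂ κ e = 1 := by
        have : inner ℂ (κ + conj w • S κ) e = inner ℂ e e := by rw [hκe]
        rw [inner_add_left, inner_smul_left, hS, mul_zero, add_zero,
          inner_self_eq_norm_sq_to_K, he] at this
        simpa using this
      have h2 : κ - e = -(conj w • S κ) := by rw [← hκe]; abel
      have h3 := norm_sub_sq (𝕜 := ℂ) κ e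
      rw [h1, h2, norm_neg, norm_smul, S.norm_map, RCLike.norm_conj, he] at h3
      simp at h3
      linarith
    have hpos : 0 < 1 - ‖w‖ ^ 2 := by nlinarith [norm_nonneg w]
    -- Substituting `κ = e - w̄ S κ` and using that the range of `S` is orthogonal to `e`, the two
    -- terms of `⟪V x, κ⟫` cancel. So `κ` is orthogonal to the range of `V`.
    have horth : ∀ x, inner ℂ (V x) κ = 0 := by
      intro x
      have h2 : inner ℂ (S (R x)) κ = - (conj w * inner ℂ (R x) κ) := by
        have : κ = e - conj w • S κ := by rw [← hκe]; abel
        conv_lhs => rw [this]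
        rw [inner_sub_right, hS, inner_smul_right, S.inner_map_map, zero_sub]
      rw [hV, inner_smul_left, inner_add_left, h2, inner_smul_left]
      ring
    have hlt : ∀ m n : ℕ, m < n → inner ℂ ((V ^ n) ((Real.sqrt (1 - ‖w‖ ^ 2) : ℂ) • κ))
        ((V ^ m) ((Real.sqrt (1 - ‖w‖ ^ 2) : ℂ) • κ)) = 0 := by
      intro m n hmn
      obtain ⟨d, rfl⟩ := Nat.exists_eq_add_of_lt hmn
      rw [show m + d + 1 = m + (1 + d) by ring, pow_add, LinearIsometry.coe_mul,
        Function.comp_apply, LinearIsometry.inner_map_map, pow_add, pow_one,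
        LinearIsometry.coe_mul, Function.comp_apply, inner_smul_right, horth, mul_zero]
    refine ⟨fun n => ?_, fun m n hmn => ?_⟩
    · rw [LinearIsometry.norm_map, norm_smul, Complex.norm_real, Real.norm_eq_abs,
        abs_of_nonneg (Real.sqrt_nonneg _)]
      refine (sq_eq_sq₀ (by positivity) zero_le_one).1 ?_
      rw [mul_pow, Real.sq_sqrt hpos.le]
      linarith
    · rcases hmn.lt_or_gt with h | h
      · rw [← inner_conj_symm, hlt _ _ h, map_zero]
      · exact hlt _ _ h
  -- With `x = (1 + w̄ S) R x`, both sides become the same polynomial in `S` applied to `R x`.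
  · intro x
    rw [hV]
    conv_rhs => rw [← hDR x]
    simp only [map_add, map_smul, smul_add, smul_smul]
    module

end Abstract

/-! ### The Hardy space of the disc as `ℓ²`, and the scalar estimate -/

/-- The space `ℓ²` of Taylor coefficients of the Hardy space of the disc. -/
abbrev Coeffs : Type := lp (fun _ : ℕ => ℂ) 2

/-- The coefficient sequence of the reproducing kernel at `z`. -/
def kernel (z : ℂ) (hz : ‖z‖ < 1) : Coeffs :=
  ⟨fun n => conj z ^ n, memℓp_gen (by
    simp only [norm_pow, RCLike.norm_conj, ENNReal.toReal_ofNat, Real.rpow_ofNat, ← pow_mul]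
    simp_rw [mul_comm _ 2, pow_mul]
    exact summable_geometric_of_lt_one (by positivity) (by nlinarith [norm_nonneg z]))⟩

/-- Evaluation at `z` is thus a bounded functional, which may be applied termwise to any convergent
series in `Coeffs`. The conjugate in `kernel` offsets the conjugate-linearity of `inner` in its
first slot. -/
theorem hasSum_inner_kernel {z : ℂ} (hz : ‖z‖ < 1) (a : Coeffs) :
    HasSum (fun n => a n * z ^ n) (inner ℂ (kernel z hz) a) := by
  refine (hasSum_congr fun n => ?_).2 (lp.hasSum_inner (𝕜 := ℂ) (kernel z hz) a)
  simp [kernel]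

/-- The isometry `a ↦ ∑ aₙ vₙ` of `ℓ²` given by an orthonormal sequence. -/
def synthesis {v : ℕ → Coeffs} (hv : Orthonormal ℂ v) : Coeffs →ₗᵢ[ℂ] Coeffs :=
  hv.orthogonalFamily.linearIsometry

theorem hasSum_synthesis {v : ℕ → Coeffs} (hv : Orthonormal ℂ v) (a : Coeffs) :
    HasSum (fun n => a n • v n) (synthesis hv a) := by
  refine (hasSum_congr fun n => ?_).2 (hv.orthogonalFamily.hasSum_linearIsometry a)
  simp

/-- The monomial `z ^ n`. -/
def monomial (n : ℕ) : Coeffs := lp.single 2 n (1 : ℂ)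

theorem orthonormal_monomial : Orthonormal ℂ monomial := by
  rw [orthonormal_iff_ite]
  intro i j
  rw [monomial, lp.inner_single_left]
  simp [monomial, Pi.single_apply]

theorem inner_kernel_monomial {z : ℂ} (hz : ‖z‖ < 1) (n : ℕ) :
    inner ℂ (kernel z hz) (monomial n) = z ^ n := by
  rw [monomial, lp.inner_single_right]
  simp [kernel]

/-- Multiplication by the coordinate `z`. -/
def shift : Coeffs →ₗᵢ[ℂ] Coeffs :=
  synthesis (orthonormal_monomial.comp _ (add_left_injective 1))

theorem inner_kernel_shift {z : ℂ} (hz : ‖z‖ < 1) (a : Coeffs) :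
    inner ℂ (kernel z hz) (shift a) = z * inner ℂ (kernel z hz) a := by
  have h1 := (hasSum_synthesis (orthonormal_monomial.comp _ (add_left_injective 1)) a).mapL
    (innerSL ℂ (kernel z hz))
  have h2 := (hasSum_inner_kernel hz a).mul_left z
  refine h1.unique ((hasSum_congr fun n => ?_).2 h2)
  simp only [innerSL_apply_apply, Function.comp_apply, inner_smul_right, inner_kernel_monomial]
  ring

/-- A multiple of `z` has no constant term; this makes the constant function `1` the vector `e` of
`exists_moebius_isometry`. -/
theorem inner_shift_monomial_zero (a : Coeffs) : inner ℂ (shift a) (monomial 0) = 0 := by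
  have h1 := (hasSum_synthesis (orthonormal_monomial.comp _ (add_left_injective 1)) a).mapL
    (innerSL ℂ (monomial 0))
  rw [← inner_conj_symm]
  refine (map_eq_zero _).2 (h1.unique ((hasSum_congr fun n => ?_).2 hasSum_zero))
  simp [orthonormal_iff_ite.1 orthonormal_monomial]

/-- Composition with a disc automorphism on the Hardy space of the disc, in terms of Taylor
coefficients, with the two-sided norm estimate. -/
theorem exists_coeffs_comp_moebius {l w : ℂ} (hl : ‖l‖ = 1) (hw : ‖w‖ < 1) (a : Coeffs) :
    ∃ b : Coeffs,
      (∀ (z : ℂ) (hz : ‖z‖ < 1), inner ℂ (kernel z hz) b =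
        inner ℂ (kernel _ (Bicomplex.norm_moebius_lt_one hl hz hw)) a) ∧
      Real.sqrt ((1 - ‖w‖) / (1 + ‖w‖)) * ‖a‖ ≤ ‖b‖ ∧
      ‖b‖ ≤ Real.sqrt ((1 + ‖w‖) / (1 - ‖w‖)) * ‖a‖ := by
  obtain ⟨V, κ, hv, hκ, hV⟩ := exists_moebius_isometry shift (orthonormal_monomial.1 0)
    inner_shift_monomial_zero hl hw
  set s : ℝ := Real.sqrt (1 - ‖w‖ ^ 2) with hs
  have hsq : 0 < 1 - ‖w‖ ^ 2 := by nlinarith [norm_nonneg w]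
  have hspos : 0 < s := Real.sqrt_pos.2 hsq
  have hs2 : s ^ 2 = (1 - ‖w‖) * (1 + ‖w‖) := by rw [hs, Real.sq_sqrt hsq.le]; ring
  have hsC : (s : ℂ) ≠ 0 := by exact_mod_cast hspos.ne'
  set y := synthesis hv a
  have hyn : ‖y‖ = ‖a‖ := LinearIsometry.norm_map _ _
  have hbn : ‖(s⁻¹ : ℂ) • (y + conj w • shift y)‖ = s⁻¹ * ‖y + conj w • shift y‖ := by
    rw [norm_smul, norm_inv, Complex.norm_real, Real.norm_eq_abs, abs_of_pos hspos]
  have hwy : ‖conj w • shift y‖ = ‖w‖ * ‖a‖ := by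
    rw [norm_smul, RCLike.norm_conj, shift.norm_map, hyn]
  have h1w : 0 < 1 - ‖w‖ := sub_pos.2 hw
  have h1w' : 0 < 1 + ‖w‖ := by positivity
  -- The function `y` is `s (f ∘ ψ) / (1 + w̄ z)`, so multiplying by `s⁻¹ (1 + w̄ z)` recovers `f ∘
  -- ψ`.
  refine ⟨(s⁻¹ : ℂ) • (y + conj w • shift y), ?_, ?_, ?_⟩
  · intro z hz
    have h0 := Bicomplex.one_add_conj_mul_ne_zero hz hw
    have hκz : inner ℂ (kernel z hz) κ = (1 + conj w * z)⁻¹ := by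
      have h := congrArg (inner ℂ (kernel z hz)) hκ
      rw [inner_add_right, inner_smul_right, inner_kernel_shift, inner_kernel_monomial,
        pow_zero] at h
      exact eq_inv_of_mul_eq_one_left (by linear_combination h)
    have hVz : ∀ x, inner ℂ (kernel z hz) (V x) =
        l * ((z + w) / (1 + conj w * z)) * inner ℂ (kernel z hz) x := by
      intro x
      have h := congrArg (inner ℂ (kernel z hz)) (hV x)
      rw [inner_add_right, inner_smul_right, inner_kernel_shift, inner_smul_right,
        inner_add_right, inner_kernel_shift, inner_smul_right] at h
      rw [mul_div_assoc', div_mul_eq_mul_div, eq_div_iff h0]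
      linear_combination h
    have hVn : ∀ n x, inner ℂ (kernel z hz) ((V ^ n) x) =
        (l * ((z + w) / (1 + conj w * z))) ^ n * inner ℂ (kernel z hz) x := by
      intro n
      induction n with
      | zero => intro x; simp
      | succ n ih =>
        intro x
        rw [pow_succ, LinearIsometry.coe_mul, Function.comp_apply, ih, hVz]
        ring
    have hyz : inner ℂ (kernel z hz) y = s * (1 + conj w * z)⁻¹ *
        inner ℂ (kernel _ (Bicomplex.norm_moebius_lt_one hl hz hw)) a := by
      refine ((hasSum_synthesis hv a).mapL (innerSL ℂ (kernel z hz))).unique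
        ((hasSum_congr fun n => ?_).2
          ((hasSum_inner_kernel (Bicomplex.norm_moebius_lt_one hl hz hw) a).mul_left
            (s * (1 + conj w * z)⁻¹)))
      rw [innerSL_apply_apply, inner_smul_right, hVn, inner_smul_right, hκz]
      ring
    rw [inner_smul_right, inner_add_right, inner_smul_right, inner_kernel_shift, hyz]
    field_simp
  · rw [hbn]
    have h : (1 - ‖w‖) * ‖a‖ ≤ ‖y + conj w • shift y‖ := by
      have := norm_sub_le_norm_add y (conj w • shift y)
      rw [hwy, hyn] at this
      linarith
    have hroot : Real.sqrt ((1 - ‖w‖) / (1 + ‖w‖)) = s⁻¹ * (1 - ‖w‖) := by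
      rw [Real.sqrt_eq_iff_mul_self_eq (by positivity) (by positivity)]
      field_simp
      rw [hs2]
    rw [hroot, mul_assoc]
    gcongr
  · rw [hbn]
    have h : ‖y + conj w • shift y‖ ≤ (1 + ‖w‖) * ‖a‖ := by
      have := norm_add_le y (conj w • shift y)
      rw [hwy, hyn] at this
      linarith
    have hroot : Real.sqrt ((1 + ‖w‖) / (1 - ‖w‖)) = s⁻¹ * (1 + ‖w‖) := by
      rw [Real.sqrt_eq_iff_mul_self_eq (by positivity) (by positivity)]
      field_simp
      rw [hs2, mul_comm]
    rw [hroot, mul_assoc]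
    gcongr

/-! ### Scalar power series on the unit disc -/

/-- A power series that converges on the unit disc to `F` is the Taylor expansion of `F`. -/
theorem hasFPowerSeriesOnBall_of_hasSum {a : ℕ → ℂ} {F : ℂ → ℂ}
    (h : ∀ z : ℂ, ‖z‖ < 1 → HasSum (fun n => a n * z ^ n) (F z)) :
    HasFPowerSeriesOnBall F (FormalMultilinearSeries.ofScalars ℂ a) 0 1 where
  r_le := by
    -- Convergence at each real `r < 1` forces the terms `aₙ rⁿ` to tend to `0`, so the radius is at
    -- least `r`.
    refine ENNReal.le_of_forall_nnreal_lt fun r hr => ?_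
    have hr1 : ‖((r : ℝ) : ℂ)‖ < 1 := by simpa using hr
    refine FormalMultilinearSeries.le_radius_of_tendsto _ (l := 0) ?_
    convert (h _ hr1).summable.tendsto_atTop_zero.norm using 2 with n
    · simp
    · simp
  r_pos := one_pos
  hasSum := by
    intro y hy
    have hy1 : ‖y‖ < 1 := by
      simpa [← ofReal_norm, ENNReal.ofReal_lt_one] using hy
    rw [zero_add]
    refine (hasSum_congr fun n => ?_).2 (h y hy1)
    simp [mul_comm]

theorem eq_of_hasSum_pow {a b : ℕ → ℂ} {F : ℂ → ℂ}
    (ha : ∀ z : ℂ, ‖z‖ < 1 → HasSum (fun n => a n * z ^ n) (F z))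
    (hb : ∀ z : ℂ, ‖z‖ < 1 → HasSum (fun n => b n * z ^ n) (F z)) : a = b :=
  FormalMultilinearSeries.ofScalars_series_injective ℂ ℂ <|
    (hasFPowerSeriesOnBall_of_hasSum ha).hasFPowerSeriesAt.eq_formalMultilinearSeries
      (hasFPowerSeriesOnBall_of_hasSum hb).hasFPowerSeriesAt

theorem differentiableAt_of_hasSum_pow {a : ℕ → ℂ} {F : ℂ → ℂ}
    (h : ∀ z : ℂ, ‖z‖ < 1 → HasSum (fun n => a n * z ^ n) (F z)) {z : ℂ} (hz : ‖z‖ < 1) :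
    DifferentiableAt ℂ F z :=
  ((hasFPowerSeriesOnBall_of_hasSum h).analyticAt_of_mem (by
    simpa [← ofReal_norm, ENNReal.ofReal_lt_one] using hz)).differentiableAt

theorem Coeffs.hasSum_norm_sq (a : Coeffs) : HasSum (fun n => ‖a n‖ ^ 2) (‖a‖ ^ 2) := by
  have := lp.hasSum_norm (p := 2) (by simp) a
  simpa using this

theorem Coeffs.exists_coe_eq {a : ℕ → ℂ} (ha : Summable fun n => ‖a n‖ ^ 2) :
    ∃ b : Coeffs, ∀ n, b n = a n :=
  ⟨⟨a, memℓp_gen (by simpa using ha)⟩, fun _ => rfl⟩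

end HardyDisc

/-! ### Reduction of bicomplex analysis to idempotent components -/

namespace Bicomplex

open HardyDisc

theorem continuous_toPair : Continuous toPair := continuous_induced_dom

theorem continuous_c₁ : Continuous c₁ := by
  have : c₁ = fun Z => (toPair Z).fst - Complex.I * (toPair Z).snd := rfl
  rw [this]
  have := continuous_toPair
  fun_prop

theorem continuous_c₂ : Continuous c₂ := by
  have : c₂ = fun Z => (toPair Z).fst + Complex.I * (toPair Z).snd := rfl
  rw [this]
  have := continuous_toPair
  fun_prop

theorem ofIdem_eq (a b : ℂ) : ofIdem a b = ⟨(a + b) / 2, Complex.I * ((a - b) / 2)⟩ := by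
  ext <;> simp [ofIdem, e₁, e₂] <;> ring

theorem continuous_ofIdem : Continuous fun p : ℂ × ℂ => ofIdem p.1 p.2 := by
  refine continuous_induced_rng.2 ?_
  have : toPair ∘ (fun p : ℂ × ℂ => ofIdem p.1 p.2) =
      fun p => WithLp.toLp 2 ((p.1 + p.2) / 2, Complex.I * ((p.1 - p.2) / 2)) := by
    ext1 p
    rw [Function.comp_apply, ofIdem_eq]
    rfl
  rw [this]
  fun_prop

/-- The first idempotent component as a ring homomorphism. -/
def c₁Hom : Bicomplex →+* ℂ where
  toFun := c₁
  map_one' := c₁_one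
  map_mul' := c₁_mul
  map_zero' := by simp [c₁]
  map_add' := c₁_add

/-- The second idempotent component as a ring homomorphism. -/
def c₂Hom : Bicomplex →+* ℂ where
  toFun := c₂
  map_one' := c₂_one
  map_mul' := c₂_mul
  map_zero' := by simp [c₂]
  map_add' := c₂_add

theorem c₁_zero : c₁ 0 = 0 := map_zero c₁Hom
theorem c₂_zero : c₂ 0 = 0 := map_zero c₂Hom
theorem c₁_sub (Z U : Bicomplex) : c₁ (Z - U) = c₁ Z - c₁ U := map_sub c₁Hom Z U
theorem c₂_sub (Z U : Bicomplex) : c₂ (Z - U) = c₂ Z - c₂ U := map_sub c₂Hom Z U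
theorem c₁_pow (Z : Bicomplex) (n : ℕ) : c₁ (Z ^ n) = c₁ Z ^ n := map_pow c₁Hom Z n
theorem c₂_pow (Z : Bicomplex) (n : ℕ) : c₂ (Z ^ n) = c₂ Z ^ n := map_pow c₂Hom Z n

theorem ext_c {Z U : Bicomplex} (h₁ : c₁ Z = c₁ U) (h₂ : c₂ Z = c₂ U) : Z = U := by
  rw [← ofIdem_c Z, ← ofIdem_c U, h₁, h₂]

/-- The inverse of the idempotent decomposition as an additive homomorphism. -/
def ofIdemHom : ℂ × ℂ →+ Bicomplex where
  toFun p := ofIdem p.1 p.2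
  map_zero' := by simp [ofIdem]
  map_add' p q := by
    apply ext_c <;> simp [c₁_add, c₂_add, c₁_ofIdem, c₂_ofIdem]

theorem hasSum_iff_c {g : ℕ → Bicomplex} {x : Bicomplex} :
    HasSum g x ↔ HasSum (fun n => c₁ (g n)) (c₁ x) ∧ HasSum (fun n => c₂ (g n)) (c₂ x) := by
  refine ⟨fun h => ⟨h.map c₁Hom continuous_c₁, h.map c₂Hom continuous_c₂⟩, fun h => ?_⟩
  have := (h.1.prodMk h.2).map ofIdemHom continuous_ofIdem
  rw [show ofIdemHom (c₁ x, c₂ x) = x from ofIdem_c x] at this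
  exact (hasSum_congr fun n => (ofIdem_c (g n)).symm).2 this

theorem hasPowerSeries_iff_c {f : unitDisc → Bicomplex} {a : ℕ → Bicomplex} :
    HasPowerSeries f a ↔ ∀ Z : unitDisc,
      HasSum (fun n => c₁ (a n) * c₁ Z ^ n) (c₁ (f Z)) ∧
      HasSum (fun n => c₂ (a n) * c₂ Z ^ n) (c₂ (f Z)) := by
  simp only [HasPowerSeries, hasSum_iff_c, c₁_mul, c₂_mul, c₁_pow, c₂_pow]

/-- The point of the bicomplex disc with both components equal to `z`. -/
def diag (z : ℂ) (hz : ‖z‖ < 1) : unitDisc :=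
  ⟨ofIdem z z, by rw [c₁_ofIdem]; exact hz, by rw [c₂_ofIdem]; exact hz⟩

theorem c₁_diag (z : ℂ) (hz : ‖z‖ < 1) : c₁ (diag z hz : Bicomplex) = z := c₁_ofIdem z z
theorem c₂_diag (z : ℂ) (hz : ‖z‖ < 1) : c₂ (diag z hz : Bicomplex) = z := c₂_ofIdem z z

theorem HasPowerSeries.unique {f : unitDisc → Bicomplex} {a b : ℕ → Bicomplex}
    (ha : HasPowerSeries f a) (hb : HasPowerSeries f b) : a = b := by
  rw [hasPowerSeries_iff_c] at ha hb
  have h₁ : (fun n => c₁ (a n)) = fun n => c₁ (b n) := by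
    -- Restricting to the diagonal of the bidisc lets one complex variable range over the whole unit
    -- disc.
    refine eq_of_hasSum_pow (F := fun z => ∑' n, c₁ (a n) * z ^ n) (fun z hz => ?_)
      (fun z hz => ?_)
    · have := (ha (diag z hz)).1
      rw [c₁_diag] at this
      exact this.summable.hasSum
    · have h := (ha (diag z hz)).1
      have h' := (hb (diag z hz)).1
      rw [c₁_diag] at h h'
      rwa [h.tsum_eq]
  have h₂ : (fun n => c₂ (a n)) = fun n => c₂ (b n) := by
    refine eq_of_hasSum_pow (F := fun z => ∑' n, c₂ (a n) * z ^ n) (fun z hz => ?_)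
      (fun z hz => ?_)
    · have := (ha (diag z hz)).2
      rw [c₂_diag] at this
      exact this.summable.hasSum
    · have h := (ha (diag z hz)).2
      have h' := (hb (diag z hz)).2
      rw [c₂_diag] at h h'
      rwa [h.tsum_eq]
  exact funext fun n => ext_c (congrFun h₁ n) (congrFun h₂ n)

theorem HasPowerSeries.coeff_eq {f : unitDisc → Bicomplex} {a : ℕ → Bicomplex}
    (ha : HasPowerSeries f a) : coeff f = a := by
  have h : ∃ a, HasPowerSeries f a := ⟨a, ha⟩
  rw [coeff, dif_pos h]
  exact h.choose_spec.unique ha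

theorem isUnit_c₁ {Z : Bicomplex} (h : IsUnit Z) : c₁ Z ≠ 0 := (h.map c₁Hom).ne_zero
theorem isUnit_c₂ {Z : Bicomplex} (h : IsUnit Z) : c₂ Z ≠ 0 := (h.map c₂Hom).ne_zero

/-- Each component of `f` is a scalar power series in the matching component of `Z` alone, so the
bicomplex difference quotient is a pair of ordinary slopes. -/
theorem HasPowerSeries.holomorphic {f : unitDisc → Bicomplex} {a : ℕ → Bicomplex}
    (ha : HasPowerSeries f a) : Holomorphic f := by
  rw [hasPowerSeries_iff_c] at ha
  set F₁ : ℂ → ℂ := fun z => ∑' n, c₁ (a n) * z ^ n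
  set F₂ : ℂ → ℂ := fun z => ∑' n, c₂ (a n) * z ^ n
  have hf₁ : ∀ Z : unitDisc, c₁ (f Z) = F₁ (c₁ Z) := fun Z => (ha Z).1.tsum_eq.symm
  have hf₂ : ∀ Z : unitDisc, c₂ (f Z) = F₂ (c₂ Z) := fun Z => (ha Z).2.tsum_eq.symm
  intro Z
  have hd₁ : DifferentiableAt ℂ F₁ (c₁ Z) := by
    refine differentiableAt_of_hasSum_pow (a := fun n => c₁ (a n)) (fun z hz => ?_) Z.2.1
    have := (ha (diag z hz)).1
    rw [c₁_diag] at this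
    exact this.summable.hasSum
  have hd₂ : DifferentiableAt ℂ F₂ (c₂ Z) := by
    refine differentiableAt_of_hasSum_pow (a := fun n => c₂ (a n)) (fun z hz => ?_) Z.2.2
    have := (ha (diag z hz)).2
    rw [c₂_diag] at this
    exact this.summable.hasSum
  set s : Set unitDisc := {U | IsUnit ((U : Bicomplex) - (Z : Bicomplex))}
  -- Invertibility of `U - Z` keeps both components away from those of `Z`, as punctured limits of
  -- slopes require.
  have ht₁ : Tendsto (fun U : unitDisc => c₁ U) (𝓝[s] Z) (𝓝[≠] (c₁ Z)) := by
    refine tendsto_nhdsWithin_iff.2 ⟨?_, ?_⟩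
    · exact ((continuous_c₁.comp continuous_subtype_val).tendsto Z).mono_left nhdsWithin_le_nhds
    · filter_upwards [self_mem_nhdsWithin] with U hU
      exact sub_ne_zero.1 (c₁_sub _ _ ▸ isUnit_c₁ hU)
  have ht₂ : Tendsto (fun U : unitDisc => c₂ U) (𝓝[s] Z) (𝓝[≠] (c₂ Z)) := by
    refine tendsto_nhdsWithin_iff.2 ⟨?_, ?_⟩
    · exact ((continuous_c₂.comp continuous_subtype_val).tendsto Z).mono_left nhdsWithin_le_nhds
    · filter_upwards [self_mem_nhdsWithin] with U hU
      exact sub_ne_zero.1 (c₂_sub _ _ ▸ isUnit_c₂ hU)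
  refine ⟨ofIdem (deriv F₁ (c₁ Z)) (deriv F₂ (c₂ Z)), ?_⟩
  have hlim := (continuous_ofIdem.tendsto (deriv F₁ (c₁ Z), deriv F₂ (c₂ Z))).comp
    (((hasDerivAt_iff_tendsto_slope.1 hd₁.hasDerivAt).comp ht₁).prodMk_nhds
      ((hasDerivAt_iff_tendsto_slope.1 hd₂.hasDerivAt).comp ht₂))
  refine hlim.congr' ?_
  filter_upwards [self_mem_nhdsWithin] with U hU
  apply ext_c
  · rw [c₁_div _ _ (isUnit_c₂ hU), c₁_sub, c₁_sub, hf₁, hf₁]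
    simp [c₁_ofIdem, slope_def_field]
  · rw [c₂_div _ _ (isUnit_c₁ hU), c₂_sub, c₂_sub, hf₂, hf₂]
    simp [c₂_ofIdem, slope_def_field]

/-! ### Hardy space functions as pairs of `ℓ²` sequences -/

/-- `f` has idempotent components with Taylor coefficients `a₁` and `a₂`. -/
def HasCoeffs (f : unitDisc → Bicomplex) (a₁ a₂ : Coeffs) : Prop :=
  ∀ Z : unitDisc, c₁ (f Z) = inner ℂ (kernel (c₁ Z) Z.2.1) a₁ ∧
    c₂ (f Z) = inner ℂ (kernel (c₂ Z) Z.2.2) a₂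

theorem HasCoeffs.hasPowerSeries {f : unitDisc → Bicomplex} {a₁ a₂ : Coeffs}
    (h : HasCoeffs f a₁ a₂) : HasPowerSeries f fun n => ofIdem (a₁ n) (a₂ n) := by
  rw [hasPowerSeries_iff_c]
  intro Z
  simp only [c₁_ofIdem, c₂_ofIdem]
  rw [(h Z).1, (h Z).2]
  exact ⟨hasSum_inner_kernel Z.2.1 a₁, hasSum_inner_kernel Z.2.2 a₂⟩

theorem c₁_hypMod_sq (Z : Bicomplex) : c₁ (hypMod Z ^ 2) = ((‖c₁ Z‖ ^ 2 : ℝ) : ℂ) := by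
  rw [c₁_pow, hypMod, c₁_ofIdem]; push_cast; rfl

theorem c₂_hypMod_sq (Z : Bicomplex) : c₂ (hypMod Z ^ 2) = ((‖c₂ Z‖ ^ 2 : ℝ) : ℂ) := by
  rw [c₂_pow, hypMod, c₂_ofIdem]; push_cast; rfl

theorem hasSum_hypMod_sq (a₁ a₂ : Coeffs) :
    HasSum (fun n => hypMod (ofIdem (a₁ n) (a₂ n)) ^ 2)
      (ofIdem ((‖a₁‖ ^ 2 : ℝ) : ℂ) ((‖a₂‖ ^ 2 : ℝ) : ℂ)) := by
  rw [hasSum_iff_c]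
  simp only [c₁_hypMod_sq, c₂_hypMod_sq, c₁_ofIdem, c₂_ofIdem]
  exact ⟨Complex.hasSum_ofReal.2 a₁.hasSum_norm_sq, Complex.hasSum_ofReal.2 a₂.hasSum_norm_sq⟩

theorem HasCoeffs.mem_hardySpace {f : unitDisc → Bicomplex} {a₁ a₂ : Coeffs}
    (h : HasCoeffs f a₁ a₂) : f ∈ hardySpace :=
  ⟨h.hasPowerSeries.holomorphic, _, h.hasPowerSeries, (hasSum_hypMod_sq a₁ a₂).summable⟩

theorem HasCoeffs.hardyNorm_eq {f : unitDisc → Bicomplex} {a₁ a₂ : Coeffs}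
    (h : HasCoeffs f a₁ a₂) : hardyNorm f = ofIdem (‖a₁‖ : ℝ) (‖a₂‖ : ℝ) := by
  rw [hardyNorm, h.hasPowerSeries.coeff_eq, (hasSum_hypMod_sq a₁ a₂).tsum_eq, hypSqrt,
    c₁_ofIdem, c₂_ofIdem, Complex.ofReal_re, Complex.ofReal_re, Real.sqrt_sq (norm_nonneg _),
    Real.sqrt_sq (norm_nonneg _)]

theorem exists_hasCoeffs {f : unitDisc → Bicomplex} (hf : f ∈ hardySpace) :
    ∃ a₁ a₂ : Coeffs, HasCoeffs f a₁ a₂ := by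
  obtain ⟨-, a, ha, hs⟩ := hf
  obtain ⟨h₁, h₂⟩ := hasSum_iff_c.1 hs.hasSum
  simp only [c₁_hypMod_sq, c₂_hypMod_sq] at h₁ h₂
  obtain ⟨a₁, h₁'⟩ := Coeffs.exists_coe_eq (Complex.summable_ofReal.1 h₁.summable)
  obtain ⟨a₂, h₂'⟩ := Coeffs.exists_coe_eq (Complex.summable_ofReal.1 h₂.summable)
  refine ⟨a₁, a₂, fun Z => ?_⟩
  obtain ⟨ha₁, ha₂⟩ := hasPowerSeries_iff_c.1 ha Z
  simp only [← h₁', ← h₂'] at ha₁ ha₂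
  exact ⟨ha₁.unique (hasSum_inner_kernel Z.2.1 _), ha₂.unique (hasSum_inner_kernel Z.2.2 _)⟩

/-! ### The automorphism and hyperbolic arithmetic in components -/

theorem c₁_discAut {lam W : Bicomplex} (hlam : hypMod lam = 1) (hW : W ∈ unitDisc)
    (Z : unitDisc) : c₁ (discAut lam W hlam hW Z : Bicomplex) =
      c₁ lam * ((c₁ Z + c₁ W) / (1 + (starRingEnd ℂ) (c₁ W) * c₁ Z)) := by
  -- The bicomplex inverse divides by `c₁ U * c₂ U`, so the first component of a quotient is the
  -- expected one only after cancelling `c₂ U`; hence the second component must not vanish.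
  have h := one_add_conj_mul_ne_zero Z.2.2 hW.2
  rw [discAut, c₁_mul, c₁_div _ _ (by rwa [c₂_add, c₂_one, c₂_mul, c₂_conj₃]), c₁_add, c₁_add,
    c₁_one, c₁_mul, c₁_conj₃]

theorem c₂_discAut {lam W : Bicomplex} (hlam : hypMod lam = 1) (hW : W ∈ unitDisc)
    (Z : unitDisc) : c₂ (discAut lam W hlam hW Z : Bicomplex) =
      c₂ lam * ((c₂ Z + c₂ W) / (1 + (starRingEnd ℂ) (c₂ W) * c₂ Z)) := by
  have h := one_add_conj_mul_ne_zero Z.2.1 hW.1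
  rw [discAut, c₂_mul, c₂_div _ _ (by rwa [c₁_add, c₁_one, c₁_mul, c₁_conj₃]), c₂_add, c₂_add,
    c₂_one, c₂_mul, c₂_conj₃]

/-- Here `Ψ(0) = λ W`, and both components of `λ` are unimodular. -/
theorem hypMod_discAut_zero {lam W : Bicomplex} (hlam : hypMod lam = 1) (hW : W ∈ unitDisc) :
    hypMod (discAut lam W hlam hW ⟨0, zero_mem_unitDisc⟩ : Bicomplex) =
      ofIdem (‖c₁ W‖ : ℝ) (‖c₂ W‖ : ℝ) := by
  obtain ⟨h₁, h₂⟩ := norm_c_of_hypMod_eq_one hlam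
  rw [hypMod, c₁_discAut, c₂_discAut]
  simp [c₁_zero, c₂_zero, h₁, h₂]

theorem hypSqrt_div {x y u v : ℝ} (hu : u ≠ 0) (hv : v ≠ 0) {α β : Bicomplex}
    (hα : α = ofIdem x y) (hβ : β = ofIdem u v) :
    hypSqrt (α / β) = ofIdem (Real.sqrt (x / u) : ℝ) (Real.sqrt (y / v) : ℝ) := by
  subst hα hβ
  rw [hypSqrt, c₁_div _ _ (by rw [c₂_ofIdem]; exact_mod_cast hv),
    c₂_div _ _ (by rw [c₁_ofIdem]; exact_mod_cast hu)]
  simp only [c₁_ofIdem, c₂_ofIdem, ← Complex.ofReal_div, Complex.ofReal_re]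

theorem ofIdem_mul (a b c d : ℂ) : ofIdem a b * ofIdem c d = ofIdem (a * c) (b * d) := by
  apply ext_c <;> simp only [c₁_mul, c₂_mul, c₁_ofIdem, c₂_ofIdem]

theorem ofIdem_mem_hyperbolic (x y : ℝ) : ofIdem x y ∈ hyperbolic :=
  ⟨(x + y) / 2, (x - y) / 2, by rw [ofIdem_eq]; push_cast; rfl⟩

theorem hypLE_ofIdem {x y u v : ℝ} (h₁ : x ≤ u) (h₂ : y ≤ v) :
    HypLE (ofIdem x y) (ofIdem u v) := by
  refine ⟨ofIdem_mem_hyperbolic _ _, ofIdem_mem_hyperbolic _ _, u - x, v - y,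
    sub_nonneg.2 h₁, sub_nonneg.2 h₂, ?_⟩
  apply ext_c <;> simp [c₁_sub, c₂_sub, c₁_ofIdem, c₂_ofIdem]

end Bicomplex

end

/-! ### The theorem, assembled from its two components -/

open Bicomplex in
theorem theorem3p6 (lam W : Bicomplex) (hlam : hypMod lam = 1) (hW : W ∈ unitDisc)
    (f : unitDisc → Bicomplex) (hf : f ∈ hardySpace) :
    compOp (discAut lam W hlam hW) f ∈ hardySpace ∧
    HypLE
      (hypSqrt
        ((1 - hypMod (discAut lam W hlam hW ⟨0, zero_mem_unitDisc⟩ : Bicomplex)) /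
          (1 + hypMod (discAut lam W hlam hW ⟨0, zero_mem_unitDisc⟩ : Bicomplex))) *
        hardyNorm f)
      (hardyNorm (compOp (discAut lam W hlam hW) f)) ∧
    HypLE
      (hardyNorm (compOp (discAut lam W hlam hW) f))
      (hypSqrt
        ((1 + hypMod (discAut lam W hlam hW ⟨0, zero_mem_unitDisc⟩ : Bicomplex)) /
          (1 - hypMod (discAut lam W hlam hW ⟨0, zero_mem_unitDisc⟩ : Bicomplex))) *
        hardyNorm f) := by
  obtain ⟨a₁, a₂, ha⟩ := exists_hasCoeffs hf
  obtain ⟨hl₁, hl₂⟩ := norm_c_of_hypMod_eq_one hlam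
  obtain ⟨b₁, hb₁, hlow₁, hupp₁⟩ := HardyDisc.exists_coeffs_comp_moebius hl₁ hW.1 a₁
  obtain ⟨b₂, hb₂, hlow₂, hupp₂⟩ := HardyDisc.exists_coeffs_comp_moebius hl₂ hW.2 a₂
  have hb : HasCoeffs (compOp (discAut lam W hlam hW) f) b₁ b₂ := by
    intro Z
    rw [hb₁, hb₂]
    have h := ha (discAut lam W hlam hW Z)
    simp only [c₁_discAut, c₂_discAut] at h
    exact h
  have hadd : 1 + ofIdem (‖c₁ W‖ : ℝ) (‖c₂ W‖ : ℝ) =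
      ofIdem ((1 + ‖c₁ W‖ : ℝ) : ℂ) ((1 + ‖c₂ W‖ : ℝ) : ℂ) := by
    apply ext_c <;> simp [c₁_add, c₂_add, c₁_one, c₂_one, c₁_ofIdem, c₂_ofIdem]
  have hsub : 1 - ofIdem (‖c₁ W‖ : ℝ) (‖c₂ W‖ : ℝ) =
      ofIdem ((1 - ‖c₁ W‖ : ℝ) : ℂ) ((1 - ‖c₂ W‖ : ℝ) : ℂ) := by
    apply ext_c <;> simp [c₁_sub, c₂_sub, c₁_one, c₂_one, c₁_ofIdem, c₂_ofIdem]
  have hW₁ : ‖c₁ W‖ < 1 := hW.1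
  have hW₂ : ‖c₂ W‖ < 1 := hW.2
  rw [ha.hardyNorm_eq, hb.hardyNorm_eq, hypMod_discAut_zero,
    hypSqrt_div (by positivity) (by positivity) hsub hadd,
    hypSqrt_div (sub_pos.2 hW₁).ne' (sub_pos.2 hW₂).ne' hadd hsub, ofIdem_mul, ofIdem_mul]
  simp only [← Complex.ofReal_mul]
  exact ⟨hb.mem_hardySpace, hypLE_ofIdem hlow₁ hlow₂, hypLE_ofIdem hupp₁ hupp₂⟩
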